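/- Consider $n$ units with fixed real potential outcomes $Y_i(1), Y_i(0)$ and effects $\tau_i = Y_i(1)-Y_i(0)$, $1\le i\le n$. Let $\tau_{(1)}\le\dots\le\tau_{(n)}$ be the sorted effects of all units. The assignment $Z\in\{0,1\}^n$ comes from a completely randomized experiment: for fixed $n_1, n_0\ge 1$ with $n_1+n_0=n$, $Z$ is uniform on the vectors with exactly $n_1$ ones, and it is independent of the potential missingness indicators $(M_i(1),M_i(0))_{i\le n}$. Outcomes are missing at random: the pairs $(M_i(1),M_i(0))$ are i.i.d. on $\{0,1\}^2$ with probabilities $p_{mm'}$ that do not depend on the potential outcomes. Let $M_i = Z_iM_i(1)+(1-Z_i)M_i(0)$ and $\mathcal S=\{i: M_i=1\}$ (the units with observed outcomes), and let $\tau_{\mathrm o(1)}\le\dots\le\tau_{\mathrm o(|\mathcal S|)}$ be the sorted effects of the units in $\mathcal S$. Let $0<\alpha<1/2$, and let $\mathcal I_{\mathrm o,k}$, $1\le k\le|\mathcal S|$, be random intervals, each of the form $(c,\infty)$ or $[c,\infty)$ (with $c=-\infty$, i.e. $\mathbb R$, allowed); put $\mathcal I_{\mathrm o,0}=\mathbb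 R$. Let $J\ge1$ and $1\le k_1<\dots<k_J\le n$. For each possible size $m\in\{0,\dots,n\}$ of $\mathcal S$, let $0\le k'_1(m)\le\dots\le k'_J(m)\le m$ be integers, and write $$\Delta_{\mathrm H}(m)=\mathbb P\Big(\bigcup_{j=1}^J\Big\{\sum_{i=j}^J\mathfrak H_i>m-k'_j(m)\Big\}\Big),$$ where $(m-\sum_{j=1}^J\mathfrak H_j,\mathfrak H_1,\dots,\mathfrak H_J)$ has the multivariate hypergeometric distribution $\mathrm{MHG}(k_1,k_2-k_1,\dots,k_J-k_{J-1},n-k_J;m)$, i.e. the law of the numbers of balls of the $J+1$ colours in a simple random sample of $m$ balls from an urn with $k_1,k_2-k_1,\dots,k_J-k_{J-1},n-k_J$ balls of the respective colours. Then: 1. For every $m$ with $\mathbb P(|\mathcal S|=m)>0$ and every $A\subseteq\{1,\dots,n\}$ with $|A|=m$, $\mathbb P(\mathcal S=A\mid|\mathcal S|=m)=\binom nm^{-1}$; that is, given its size, $\mathcal S$ is a simple random sample of all units. 2. Every $\mathcal I_{\mathrm o,k'_j(|\mathcal S|)}$ is of the form $(c,\infty)$ or $[c,\infty)$ with $c\in[-\infty,\infty)$.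 3. For every $m$ with $\mathbb P(|\mathcal S|=m)>0$: if, conditionally on $|\mathcal S|=m$, the $\mathcal I_{\mathrm o,k}$ are $1-2\alpha$ simultaneous prediction intervals for the $\tau_{\mathrm o(k)}$, i.e. $\mathbb P(\tau_{\mathrm o(k)}\in\mathcal I_{\mathrm o,k}\ \forall\,1\le k\le|\mathcal S| \mid |\mathcal S|=m)\ge1-2\alpha$, then $$\mathbb P\big(\tau_{(k_j)}\in\mathcal I_{\mathrm o,k'_j(m)}\ \forall\,1\le j\le J\ \big|\ |\mathcal S|=m\big)\ge1-2\alpha-\Delta_{\mathrm H}(m).$$ 4. If the $\mathcal I_{\mathrm o,k}$ are unconditionally $1-2\alpha$ simultaneous prediction intervals, i.e. $\mathbb P(\tau_{\mathrm o(k)}\in\mathcal I_{\mathrm o,k}\ \forall\,1\le k\le|\mathcal S|)\ge1-2\alpha$, then $$\mathbb P\big(\tau_{(k_j)}\in\mathcal I_{\mathrm o,k'_j(|\mathcal S|)}\ \forall\,1\le j\le J\big)\ge1-2\alpha-\mathbb E\big[\Delta_{\mathrm H}(|\mathcal S|)\big].$$ -/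

import Mathlib

open MeasureTheory ProbabilityTheory

noncomputable section

namespace Attrition

/-- Completely randomized experiment on `n` units with `n₁` treated units: `Z` is uniform on the
assignments with exactly `n₁` treated units, and it is independent of the potential missingness
indicators `(M(1), M(0))`. The potential outcomes are constants, so conditioning on them is void. -/
structure IsCRE {Ω : Type*} [MeasurableSpace Ω] (P : Measure Ω) {n : ℕ} (n₁ : ℕ)
    (Z M₁ M₀ : Ω → Fin n → Bool) : Prop where
  law : ∀ z : Fin n → Bool, P.real {ω | Z ω = z} =
    if (Finset.univ.filter (fun i => z i = true)).card = n₁ then 1 / (n.choose n₁ : ℝ) else 0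
  indep : IndepFun Z (fun ω => (M₁ ω, M₀ ω)) P

/-- Missing at random: the pairs `(M_i(1), M_i(0))` are i.i.d. with probability mass `p (m, m')`
at `(m, m')`. -/
structure IsMAR {Ω : Type*} [MeasurableSpace Ω] (P : Measure Ω) {n : ℕ}
    (M₁ M₀ : Ω → Fin n → Bool) (p : Bool × Bool → ℝ) : Prop where
  nonneg : ∀ c, 0 ≤ p c
  sum_eq_one : ∑ c, p c = 1
  indep : iIndepFun (fun (i : Fin n) (ω : Ω) => (M₁ ω i, M₀ ω i)) P
  law : ∀ (i : Fin n) (c : Bool × Bool), P.real {ω | (M₁ ω i, M₀ ω i) = c} = p c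

/-- The realized indicator `M_i = Z_i M_i(1) + (1 - Z_i) M_i(0)`; the value `true` means that the
outcome of the unit is observed. -/
def realizedM {Ω : Type*} {n : ℕ} (Z M₁ M₀ : Ω → Fin n → Bool) (ω : Ω) (i : Fin n) : Bool :=
  if Z ω i = true then M₁ ω i else M₀ ω i

/-- The set `S = {i : M_i = 1}` of units with observed outcomes. -/
def observedSet {Ω : Type*} {n : ℕ} (Z M₁ M₀ : Ω → Fin n → Bool) (ω : Ω) : Finset (Fin n) :=
  Finset.univ.filter (fun i => realizedM Z M₁ M₀ ω i = true)

/-- Individual treatment effects `τ_i = Y_i(1) - Y_i(0)`. -/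
def effect {n : ℕ} (Y₁ Y₀ : Fin n → ℝ) (i : Fin n) : ℝ := Y₁ i - Y₀ i

/-- The `k`-th smallest value (with multiplicity) of `τ` over the units in `A`, where
`1 ≤ k ≤ A.card`; the default value outside this range is never used. -/
def sortedEffect {n : ℕ} (τ : Fin n → ℝ) (A : Finset (Fin n)) (k : ℕ) : ℝ :=
  ((A.val.map τ).sort (· ≤ ·)).getD (k - 1) 0

/-- One-sided intervals `(c, ∞)` or `[c, ∞)`, where `c = -∞` (the real line) is allowed. -/
def IsLowerBoundInterval (I : Set ℝ) : Prop :=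
  I = Set.univ ∨ ∃ c : ℝ, I = Set.Ioi c ∨ I = Set.Ici c

/-- A family of intervals indexed by `k ≥ 1`, extended to `k = 0` by the real line. -/
def extendZero (I : ℕ → Set ℝ) (k : ℕ) : Set ℝ := if k = 0 then Set.univ else I k

/-- Probability mass at `h` of the multivariate hypergeometric distribution `MHG(K; m)`: the
probability that a simple random sample of `m` balls, from an urn with `K i` balls of colour `i`,
has exactly `h i` balls of each colour `i`. -/
def mhgMass {r : ℕ} (K : Fin r → ℕ) (m : ℕ) (h : Fin r → ℕ) : ℝ :=
  if ∑ i, h i = m then (∏ i, ((K i).choose (h i) : ℝ)) / ((∑ i, K i).choose m : ℝ) else 0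

/-- Probability of the event `E` under `MHG(K; m)`, which lives on the `h` with `h i ≤ K i`. -/
def mhgProb {r : ℕ} (K : Fin r → ℕ) (m : ℕ) (E : Set (Fin r → ℕ)) : ℝ :=
  open Classical in
  ∑ h ∈ (Fintype.piFinset (fun i => Finset.range (K i + 1))).filter (fun h => h ∈ E),
    mhgMass K m h

/-- The cut points `0, k_1, …, k_J, n`. -/
def cutPoint {J : ℕ} (n : ℕ) (k : Fin J → ℕ) : Fin (J + 2) → ℕ :=
  Fin.snoc (α := fun _ => ℕ) (Fin.cons (α := fun _ => ℕ) 0 k) n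

/-- The colour sizes `k_1, k_2 - k_1, …, k_J - k_{J-1}, n - k_J`. -/
def urnSizes {J : ℕ} (n : ℕ) (k : Fin J → ℕ) (i : Fin (J + 1)) : ℕ :=
  cutPoint n k i.succ - cutPoint n k i.castSucc

/-- `Δ_H(k'; n, m, k) = P(⋃_j {∑_{i ≥ j} H_i > m - k'_j})`, where `(H_0, H_1, …, H_J)`, with
`H_0 = m - ∑_{i ≥ 1} H_i`, follows `MHG(k_1, k_2 - k_1, …, k_J - k_{J-1}, n - k_J; m)`. The index
`j : Fin J` counts from `0`, so the sum starts at the colour `j.succ`. -/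
def deltaH {J : ℕ} (k' : Fin J → ℕ) (n m : ℕ) (k : Fin J → ℕ) : ℝ :=
  mhgProb (urnSizes n k) m
    {h | ∃ j : Fin J, (m : ℤ) - (k' j : ℤ) < ∑ i ∈ Finset.Ici j.succ, (h i : ℤ)}

/-- The event that `I_k` contains the `k`-th smallest effect among the units in `S`,
simultaneously for all `1 ≤ k ≤ |S|`. -/
def predictionEvent {Ω : Type*} {n : ℕ} (τ : Fin n → ℝ) (S : Ω → Finset (Fin n))
    (I : Ω → ℕ → Set ℝ) : Set Ω :=
  {ω | ∀ l : ℕ, 1 ≤ l → l ≤ (S ω).card → sortedEffect τ (S ω) l ∈ I ω l}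

/-- The event that `I_{k'_j}` contains the effect quantile `τ_(k_j)` among all units,
simultaneously for all `j`; here `k'` is chosen as a function of the size of `S`. -/
def coverageEvent {Ω : Type*} {n J : ℕ} (τ : Fin n → ℝ) (S : Ω → Finset (Fin n))
    (I : Ω → ℕ → Set ℝ) (k : Fin J → ℕ) (k' : ℕ → Fin J → ℕ) : Set Ω :=
  {ω | ∀ j : Fin J, sortedEffect τ Finset.univ (k j) ∈ extendZero (I ω) (k' (S ω).card j)}

end Attrition

end

/-! Rank all units once by effect, ties broken by `Tuple.sort τ`. If at most `m - k'_j` of the `m`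
observed units have rank above `k_j`, then at least `k'_j` of them have effect at most `τ_(k_j)`, so
the `k'_j`-th smallest observed effect lies below `τ_(k_j)` (`sortedEffect_le_sortedEffect_univ`).
The intervals are upward closed, so prediction of the former covers the latter. Coverage can thus
fail only if prediction fails or the observed set lies in `badSamples`.

The law of the observed set depends only on its size: relabelling the units preserves both the
assignment law and the i.i.d. missingness. Hence, given its size, it is a simple random sample, and
the bad event has probability `deltaH`, a count of samples by colour. A union bound finishes. No
independence between the intervals and the observed set is needed, since only the bad event's
marginal probability enters. -/

namespace Attrition

/-! ### Counting: `deltaH` as a proportion of samples. -/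

section Urn

/-- The number of sets meeting each fibre of `c` in a prescribed number of points. -/
theorem card_filter_fiber_card_eq {ι κ : Type*} [Fintype ι] [DecidableEq ι] [Fintype κ]
    [DecidableEq κ] (c : ι → κ) (h : κ → ℕ) :
    (Finset.univ.filter
      (fun A : Finset ι => (fun i => (A.filter (fun a => c a = i)).card) = h)).card =
      ∏ i, ((Finset.univ.filter (fun a => c a = i)).card).choose (h i) := by
  -- A set is the same as the family of its traces on the fibres, each chosen freely.
  have hR : ∏ i, ((Finset.univ.filter (fun a => c a = i)).card).choose (h i) =
      (Fintype.piFinset (fun i =>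
        (Finset.univ.filter (fun a => c a = i)).powersetCard (h i))).card := by
    simp [Fintype.card_piFinset]
  rw [hR]
  refine Finset.card_nbij' (fun A i => A.filter (fun a => c a = i))
    (fun F => Finset.univ.filter (fun a => a ∈ F (c a))) ?_ ?_ ?_ ?_
  · intro A hA
    simp only [Finset.coe_filter, Finset.mem_univ, true_and, Set.mem_ofPred_eq] at hA
    simp only [Finset.mem_coe, Fintype.mem_piFinset, Finset.mem_powersetCard]
    intro i
    exact ⟨Finset.filter_subset_filter _ (Finset.subset_univ _), congrFun hA i⟩
  · intro F hF
    simp only [Finset.mem_coe, Fintype.mem_piFinset, Finset.mem_powersetCard] at hF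
    simp only [Finset.coe_filter, Finset.mem_univ, true_and, Set.mem_ofPred_eq]
    funext i
    rw [← (hF i).2]
    congr 1
    ext a
    have := @(hF i).1 a
    simp only [Finset.mem_filter, Finset.mem_univ, true_and] at this ⊢
    constructor
    · rintro ⟨h1, rfl⟩; exact h1
    · intro h1
      have h2 := this h1
      subst h2
      exact ⟨h1, rfl⟩
  · intro A _
    ext a
    simp
  · intro F hF
    simp only [Finset.mem_coe, Fintype.mem_piFinset, Finset.mem_powersetCard] at hF
    funext i
    ext a
    have := @(hF i).1 a
    simp only [Finset.mem_filter, Finset.mem_univ, true_and] at this ⊢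
    constructor
    · rintro ⟨h1, rfl⟩; exact h1
    · intro h1
      have h2 := this h1
      subst h2
      exact ⟨h1, rfl⟩

/-- The multivariate hypergeometric law is the law of the colour counts of a simple random
sample. -/
theorem mhgProb_eq_card_div {n r : ℕ} (c : Fin n → Fin r) (K : Fin r → ℕ)
    (hK : ∀ i, (Finset.univ.filter (fun a => c a = i)).card = K i) (m : ℕ)
    (E : Set (Fin r → ℕ)) [DecidablePred (· ∈ E)] :
    mhgProb K m E =
      (Finset.univ.filter (fun A : Finset (Fin n) => A.card = m ∧
        (fun i => (A.filter (fun a => c a = i)).card) ∈ E)).card / (n.choose m : ℝ) := by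
  classical
  have hsum : ∑ i, K i = n := by
    have := Finset.card_eq_sum_card_fiberwise (s := (Finset.univ : Finset (Fin n)))
      (t := Finset.univ) (f := c) (fun _ _ => Finset.mem_coe.2 (Finset.mem_univ _))
    simp only [Finset.card_univ, Fintype.card_fin] at this
    rw [this]
    exact Finset.sum_congr rfl (fun i _ => (hK i).symm)
  have hcard : ∀ A : Finset (Fin n),
      ∑ i, (A.filter (fun a => c a = i)).card = A.card := fun A =>
    (Finset.card_eq_sum_card_fiberwise (fun _ _ => Finset.mem_coe.2 (Finset.mem_univ _))).symm
  unfold mhgProb mhgMass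
  rw [hsum]
  have hmap : ∀ A ∈ Finset.univ.filter (fun A : Finset (Fin n) => A.card = m ∧
        (fun i => (A.filter (fun a => c a = i)).card) ∈ E),
      (fun i => (A.filter (fun a => c a = i)).card) ∈
        (Fintype.piFinset (fun i => Finset.range (K i + 1))).filter (fun h => h ∈ E) := by
    intro A hA
    simp only [Finset.mem_filter, Finset.mem_univ, true_and] at hA
    simp only [Finset.mem_filter, Fintype.mem_piFinset, Finset.mem_range]
    refine ⟨fun i => ?_, hA.2⟩
    rw [← hK i]
    exact Nat.lt_succ_of_le
      (Finset.card_le_card (Finset.filter_subset_filter _ (Finset.subset_univ _)))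
  rw [Finset.card_eq_sum_card_fiberwise hmap, Nat.cast_sum, Finset.sum_div]
  refine Finset.sum_congr (by congr) (fun h hh => ?_)
  have hhE : h ∈ E := (Finset.mem_filter.1 hh).2
  rw [Finset.filter_filter]
  split_ifs with hm
  · congr 1
    have hfilter : (Finset.univ.filter (fun A : Finset (Fin n) => (A.card = m ∧
        (fun i => (A.filter (fun a => c a = i)).card) ∈ E) ∧
        (fun i => (A.filter (fun a => c a = i)).card) = h)) =
        Finset.univ.filter (fun A : Finset (Fin n) =>
          (fun i => (A.filter (fun a => c a = i)).card) = h) := by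
      ext A
      simp only [Finset.mem_filter, Finset.mem_univ, true_and]
      refine ⟨fun H => H.2, fun H => ⟨⟨?_, H ▸ hhE⟩, H⟩⟩
      rw [← hcard A, ← hm]
      exact Finset.sum_congr rfl (fun i _ => congrFun H i)
    rw [hfilter, card_filter_fiber_card_eq]
    simp only [hK]
    push_cast
    rfl
  -- Colour counts of a sample of size `m` sum to `m`, so this fibre is empty.
  · rw [Finset.filter_eq_empty_iff.2]
    · simp
    · rintro A - ⟨⟨h1, -⟩, rfl⟩
      exact hm ((hcard A).trans h1)

/-- The colour of the ball with (zero-based) rank `r`: the number of cut points `k j ≤ r`. -/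
def rankColour {J : ℕ} (k : Fin J → ℕ) (r : ℕ) : Fin (J + 1) :=
  ⟨(Finset.univ.filter (fun j => k j ≤ r)).card,
    Nat.lt_succ_of_le ((Finset.card_filter_le _ _).trans (by simp))⟩

/-- The cut points increase, so those at most `r` form an initial segment of `Fin J`; counting them
tells whether `j` belongs to it. -/
theorem succ_le_rankColour {J : ℕ} {k : Fin J → ℕ} (hk : StrictMono k) (r : ℕ) (j : Fin J) :
    j.succ ≤ rankColour k r ↔ k j ≤ r := by
  rw [Fin.le_def]
  simp only [rankColour, Fin.val_succ]
  constructor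
  · intro h
    by_contra hj
    have hsub : Finset.univ.filter (fun i => k i ≤ r) ⊆ Finset.Iio j := by
      intro i hi
      simp only [Finset.mem_filter, Finset.mem_univ, true_and] at hi
      rw [Finset.mem_Iio]
      exact hk.lt_iff_lt.1 (by omega)
    have := Finset.card_le_card hsub
    rw [Fin.card_Iio] at this
    omega
  · intro h
    have hsub : Finset.Iic j ⊆ Finset.univ.filter (fun i => k i ≤ r) := by
      intro i hi
      simp only [Finset.mem_filter, Finset.mem_univ, true_and]
      exact (hk.monotone (Finset.mem_Iic.1 hi)).trans h
    have := Finset.card_le_card hsub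
    rwa [Fin.card_Iic] at this

theorem cutPoint_zero {J : ℕ} (n : ℕ) (k : Fin J → ℕ) : cutPoint n k 0 = 0 := by
  have h : (0 : Fin (J + 2)) = Fin.castSucc (0 : Fin (J + 1)) := rfl
  rw [cutPoint, h, Fin.snoc_castSucc, Fin.cons_zero]

theorem cutPoint_last {J : ℕ} (n : ℕ) (k : Fin J → ℕ) : cutPoint n k (Fin.last (J + 1)) = n := by
  rw [cutPoint, Fin.snoc_last]

theorem cutPoint_succ_castSucc {J : ℕ} (n : ℕ) (k : Fin J → ℕ) (j : Fin J) :
    cutPoint n k j.succ.castSucc = k j := by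
  rw [cutPoint, Fin.snoc_castSucc, Fin.cons_succ]

theorem cutPoint_le {J n : ℕ} {k : Fin J → ℕ} (hkn : ∀ j, k j ≤ n) (i : Fin (J + 2)) :
    cutPoint n k i ≤ n := by
  refine Fin.lastCases ?_ (fun i => ?_) i
  · rw [cutPoint_last]
  · refine Fin.cases ?_ (fun j => ?_) i
    · simp [cutPoint_zero]
    · rw [cutPoint_succ_castSucc]; exact hkn j

theorem cutPoint_le_iff {J n : ℕ} {k : Fin J → ℕ} (hk : StrictMono k) {r : ℕ} (hr : r < n)
    (i : Fin (J + 2)) : cutPoint n k i ≤ r ↔ i.val ≤ (rankColour k r).val := by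
  refine Fin.lastCases ?_ (fun i => ?_) i
  · rw [cutPoint_last]
    have := (rankColour k r).isLt
    simp only [Fin.val_last]
    omega
  · refine Fin.cases ?_ (fun j => ?_) i
    · simp [cutPoint_zero]
    · rw [cutPoint_succ_castSucc, ← succ_le_rankColour hk, Fin.le_def]
      rfl

/-- A colour class is an interval of ranks between consecutive cut points, and `σ` hits each rank
once. -/
theorem card_rankColour_eq {J n : ℕ} {k : Fin J → ℕ} (hk : StrictMono k) (hkn : ∀ j, k j ≤ n)
    (σ : Equiv.Perm (Fin n)) (i : Fin (J + 1)) :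
    (Finset.univ.filter (fun a => rankColour k (σ a).val = i)).card = urnSizes n k i := by
  have h : (Finset.univ.filter (fun a => rankColour k (σ a).val = i)).card =
      (Finset.Ico (cutPoint n k i.castSucc) (cutPoint n k i.succ)).card := by
    refine Finset.card_nbij (fun a => (σ a).val) ?_ ?_ ?_
    · intro a ha
      simp only [Finset.coe_filter, Finset.mem_univ, true_and, Set.mem_ofPred_eq] at ha
      rw [Finset.mem_coe, Finset.mem_Ico, ← not_le, cutPoint_le_iff hk (σ a).isLt,
        cutPoint_le_iff hk (σ a).isLt, ha]
      simp
    · intro a _ b _ hab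
      exact σ.injective (Fin.ext hab)
    · intro r hr
      simp only [Finset.coe_Ico, Set.mem_Ico] at hr
      have hrn : r < n := lt_of_lt_of_le hr.2 (cutPoint_le hkn _)
      refine ⟨σ.symm ⟨r, hrn⟩, ?_, by simp⟩
      rw [← not_le, cutPoint_le_iff hk hrn, cutPoint_le_iff hk hrn] at hr
      simp only [Finset.coe_filter, Finset.mem_univ, true_and, Set.mem_ofPred_eq,
        Equiv.apply_symm_apply]
      ext
      simp only [Fin.val_castSucc, Fin.val_succ] at hr
      omega
  rw [h, Nat.card_Ico, urnSizes]

/-- The samples of size `m` for which, for some `j`, more than `m - k' j` of the sampled units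
have rank exceeding `k j`. -/
def badSamples {n J : ℕ} (ρ : Equiv.Perm (Fin n)) (k k' : Fin J → ℕ) (m : ℕ) :
    Finset (Finset (Fin n)) :=
  Finset.univ.filter (fun A => A.card = m ∧
    ∃ j, m < (A.filter (fun a => k j ≤ (ρ a).val)).card + k' j)

/-- The colours from `j.succ` on are exactly the zero-based ranks at least `k j`, so the tail sum of
colour counts is the count in `badSamples`. -/
theorem deltaH_eq_card_div {n J : ℕ} (ρ : Equiv.Perm (Fin n)) {k : Fin J → ℕ}
    (hk : StrictMono k) (hkn : ∀ j, k j ≤ n) (k' : Fin J → ℕ) (m : ℕ) :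
    deltaH k' n m k = (badSamples ρ k k' m).card / (n.choose m : ℝ) := by
  classical
  rw [deltaH, mhgProb_eq_card_div (fun a => rankColour k (ρ a).val) _
    (card_rankColour_eq hk hkn ρ)]
  congr 3
  ext A
  simp only [badSamples, Finset.mem_filter, Finset.mem_univ, true_and, Set.mem_ofPred_eq]
  refine and_congr_right (fun _ => exists_congr (fun j => ?_))
  have hcount : ∑ i ∈ Finset.Ici j.succ,
      (A.filter (fun a => rankColour k (ρ a).val = i)).card =
      (A.filter (fun a => k j ≤ (ρ a).val)).card := by
    rw [Finset.card_eq_sum_card_fiberwise (s := A.filter (fun a => k j ≤ (ρ a).val))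
      (t := Finset.Ici j.succ) (f := fun a => rankColour k (ρ a).val)]
    · refine Finset.sum_congr rfl (fun i hi => ?_)
      congr 1
      ext a
      simp only [Finset.mem_filter, and_assoc]
      refine and_congr_right (fun _ => ⟨fun h => ⟨?_, h⟩, fun h => h.2⟩)
      rw [← succ_le_rankColour hk, h]
      exact Finset.mem_Ici.1 hi
    · intro a ha
      simp only [Finset.coe_filter, Set.mem_ofPred_eq] at ha
      rw [Finset.mem_coe, Finset.mem_Ici, succ_le_rankColour hk]
      exact ha.2
  have hcount' : ∑ i ∈ Finset.Ici j.succ,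
      ((A.filter (fun a => rankColour k (ρ a).val = i)).card : ℤ) =
      (A.filter (fun a => k j ≤ (ρ a).val)).card := by exact_mod_cast hcount
  rw [hcount']
  omega

end Urn

/-! ### Order statistics of a sample against those of the population. -/

section SortedEffects

theorem getD_le_of_le_countP {L : List ℝ} (hL : L.Pairwise (· ≤ ·)) {x : ℝ} {l : ℕ}
    (hl : 1 ≤ l) (h : l ≤ L.countP (fun y => decide (y ≤ x))) : L.getD (l - 1) 0 ≤ x := by
  have hlen : l ≤ L.length := h.trans List.countP_le_length
  have hlt : l - 1 < L.length := by omega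
  rw [List.getD_eq_getElem _ _ hlt]
  by_contra hx
  -- If entry `l - 1` exceeds `x`, so does all that follows; at most `l - 1` entries are then `≤ x`.
  have hdrop : (L.drop (l - 1)).countP (fun y => decide (y ≤ x)) = 0 := by
    rw [List.countP_eq_zero]
    intro y hy
    obtain ⟨i, hi, rfl⟩ := List.mem_iff_getElem.1 hy
    rw [List.getElem_drop]
    simp only [decide_eq_true_eq]
    intro hle
    refine hx (le_trans ?_ hle)
    exact hL.rel_get_of_le (a := ⟨l - 1, hlt⟩) (b := ⟨l - 1 + i, by
      rw [List.length_drop] at hi; omega⟩) (Fin.le_def.2 (Nat.le_add_right _ _))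
  rw [← List.take_append_drop (l - 1) L, List.countP_append, hdrop, add_zero] at h
  have h2 := h.trans List.countP_le_length
  rw [List.length_take] at h2
  omega

theorem sortedEffect_le_of_le_card {n : ℕ} (τ : Fin n → ℝ) (A : Finset (Fin n)) {x : ℝ} {l : ℕ}
    (hl : 1 ≤ l) (h : l ≤ (A.filter (fun a => τ a ≤ x)).card) : sortedEffect τ A l ≤ x := by
  refine getD_le_of_le_countP (Multiset.pairwise_sort _ _) hl (h.trans (le_of_eq ?_))
  rw [← Multiset.coe_countP, Multiset.sort_eq, Multiset.countP_map]
  rfl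

theorem sortedEffect_univ {n : ℕ} (τ : Fin n → ℝ) {l : ℕ} (hl : 1 ≤ l) (hln : l ≤ n) :
    sortedEffect τ Finset.univ l = τ (Tuple.sort τ ⟨l - 1, by omega⟩) := by
  have hL : ((Finset.univ : Finset (Fin n)).val.map τ).sort (· ≤ ·) =
      List.ofFn (τ ∘ Tuple.sort τ) := by
    refine List.Perm.eq_of_pairwise' (Multiset.pairwise_sort _ _)
      (Tuple.monotone_sort τ).sortedLE_ofFn.pairwise ?_
    rw [← Multiset.coe_eq_coe, Multiset.sort_eq, Fin.univ_val_map, Multiset.coe_eq_coe]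
    exact ((Tuple.sort τ).ofFn_comp_perm τ).symm
  rw [sortedEffect, hL, List.getD_eq_getElem _ _ (by rw [List.length_ofFn]; omega),
    List.getElem_ofFn]
  rfl

theorem IsLowerBoundInterval.mem_of_le {I : Set ℝ} (hI : IsLowerBoundInterval I) {x y : ℝ}
    (hx : x ∈ I) (hxy : x ≤ y) : y ∈ I := by
  rcases hI with rfl | ⟨c, rfl | rfl⟩
  · trivial
  · exact lt_of_lt_of_le hx hxy
  · exact le_trans hx hxy

/-- If at most `|A| - l'` units of `A` have rank exceeding `l`, then the `l'`-th smallest effect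
in `A` is at most the `l`-th smallest effect of all units. -/
theorem sortedEffect_le_sortedEffect_univ {n : ℕ} (τ : Fin n → ℝ) (A : Finset (Fin n))
    {l l' : ℕ} (hl : 1 ≤ l) (hln : l ≤ n) (hl' : 1 ≤ l')
    (h : (A.filter (fun a => l ≤ ((Tuple.sort τ).symm a).val)).card + l' ≤ A.card) :
    sortedEffect τ A l' ≤ sortedEffect τ Finset.univ l := by
  refine sortedEffect_le_of_le_card τ A hl' ?_
  rw [sortedEffect_univ τ hl hln]
  have hsplit := Finset.card_filter_add_card_filter_not (s := A)
    (fun a => l ≤ ((Tuple.sort τ).symm a).val)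
  have hsub : A.filter (fun a => ¬ l ≤ ((Tuple.sort τ).symm a).val) ⊆
      A.filter (fun a => τ a ≤ τ (Tuple.sort τ ⟨l - 1, by omega⟩)) := by
    intro a ha
    simp only [Finset.mem_filter] at ha ⊢
    refine ⟨ha.1, ?_⟩
    have := Tuple.monotone_sort τ (a := (Tuple.sort τ).symm a) (b := ⟨l - 1, by omega⟩)
      (Fin.le_def.2 (by simp only; omega))
    simpa using this
  have := Finset.card_le_card hsub
  omega

theorem mem_coverageEvent_of_notMem_badSamples {Ω : Type*} {n J : ℕ} {τ : Fin n → ℝ}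
    {S : Ω → Finset (Fin n)} {I : Ω → ℕ → Set ℝ} {ω : Ω}
    (hI : ∀ l, 1 ≤ l → l ≤ (S ω).card → IsLowerBoundInterval (I ω l))
    {k : Fin J → ℕ} (hk1 : ∀ j, 1 ≤ k j) (hkn : ∀ j, k j ≤ n)
    {k' : ℕ → Fin J → ℕ} (hk'm : ∀ m ≤ n, ∀ j, k' m j ≤ m)
    (hpred : ω ∈ predictionEvent τ S I)
    (hbad : S ω ∉ badSamples (Tuple.sort τ).symm k (k' (S ω).card) (S ω).card) :
    ω ∈ coverageEvent τ S I k k' := by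
  intro j
  -- For `k'_j = 0` the interval is the whole line.
  by_cases h0 : k' (S ω).card j = 0
  · simp [extendZero, h0]
  · rw [extendZero, if_neg h0]
    have h1 : 1 ≤ k' (S ω).card j := Nat.one_le_iff_ne_zero.2 h0
    have hle := hk'm _ (by simpa using Finset.card_le_univ (S ω)) j
    refine (hI _ h1 hle).mem_of_le (hpred _ h1 hle) ?_
    refine sortedEffect_le_sortedEffect_univ τ _ (hk1 j) (hkn j) h1 ?_
    by_contra hlt
    exact hbad (Finset.mem_filter.2 ⟨Finset.mem_univ _, rfl, j, not_le.1 hlt⟩)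

end SortedEffects

/-! ### The observed set is exchangeable. -/

section Sampling

variable {Ω : Type*} [MeasurableSpace Ω] {P : Measure Ω} [IsProbabilityMeasure P]
  {n n₁ : ℕ} {Z M₁ M₀ : Ω → Fin n → Bool} {p : Bool × Bool → ℝ}

theorem measureReal_cond_apply {s : Set Ω} (hs : MeasurableSet s) (μ : Measure Ω) (t : Set Ω) :
    (μ[|s]).real t = (μ.real s)⁻¹ * μ.real (s ∩ t) := by
  rw [measureReal_def, cond_apply hs, ENNReal.toReal_mul, ENNReal.toReal_inv]
  rfl

theorem measurableSet_observedSet_mem (hZ : Measurable Z) (hM₁ : Measurable M₁)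
    (hM₀ : Measurable M₀) (B : Set (Finset (Fin n))) :
    MeasurableSet {ω | observedSet Z M₁ M₀ ω ∈ B} := by
  have h : MeasurableSet ((fun ω => (Z ω, M₁ ω, M₀ ω)) ⁻¹'
      {x : (Fin n → Bool) × (Fin n → Bool) × (Fin n → Bool) |
        Finset.univ.filter (fun i => (if x.1 i = true then x.2.1 i else x.2.2 i) = true) ∈ B}) :=
    (hZ.prodMk (hM₁.prodMk hM₀)) (Set.toFinite _).measurableSet
  exact h

theorem measureReal_observedSet_mem (hZ : Measurable Z) (hM₁ : Measurable M₁)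
    (hM₀ : Measurable M₀) (B : Finset (Finset (Fin n))) :
    P.real {ω | observedSet Z M₁ M₀ ω ∈ B} =
      ∑ A ∈ B, P.real {ω | observedSet Z M₁ M₀ ω = A} := by
  rw [← measureReal_biUnion_finset]
  · congr 1
    ext ω
    simp
  · intro A _ A' _ hne
    refine Set.disjoint_left.2 (fun ω h h' => hne ?_)
    exact Eq.trans (Eq.symm h) h'
  · intro A _
    exact measurableSet_observedSet_mem hZ hM₁ hM₀ {A}

/-- Probability, under the missingness law `p`, that a unit with assignment `z` has realized
indicator `b`. -/
def realizedMass (p : Bool × Bool → ℝ) (z b : Bool) : ℝ :=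
  ∑ c ∈ Finset.univ.filter (fun c : Bool × Bool => (if z = true then c.1 else c.2) = b), p c

theorem IsMAR.measureReal_forall (hM₁ : Measurable M₁) (hM₀ : Measurable M₀)
    (hMAR : IsMAR P M₁ M₀ p) (z b : Fin n → Bool) :
    P.real {ω | ∀ i, (if z i = true then M₁ ω i else M₀ ω i) = b i} =
      ∏ i, realizedMass p (z i) (b i) := by
  have hmeas : ∀ i, Measurable (fun ω => (M₁ ω i, M₀ ω i)) := fun i =>
    ((measurable_pi_apply i).comp hM₁).prodMk ((measurable_pi_apply i).comp hM₀)
  have h := hMAR.indep.measure_inter_preimage_eq_mul Finset.univ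
    (sets := fun i => {c : Bool × Bool | (if z i = true then c.1 else c.2) = b i})
    (fun i _ => (Set.toFinite _).measurableSet)
  have h2 := congrArg ENNReal.toReal h
  rw [ENNReal.toReal_prod] at h2
  convert h2 using 1
  · rw [measureReal_def]
    congr 2
    ext ω
    simp
  · refine Finset.prod_congr rfl (fun i _ => ?_)
    rw [realizedMass, ← measureReal_def]
    have hU : (fun ω => (M₁ ω i, M₀ ω i)) ⁻¹'
        {c : Bool × Bool | (if z i = true then c.1 else c.2) = b i} =
        ⋃ c ∈ Finset.univ.filter
          (fun c : Bool × Bool => (if z i = true then c.1 else c.2) = b i),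
          {ω | (M₁ ω i, M₀ ω i) = c} := by
      ext ω
      simp
    rw [hU, measureReal_biUnion_finset]
    · exact Finset.sum_congr rfl (fun c _ => (hMAR.law i c).symm)
    · intro A _ A' _ hne
      refine Set.disjoint_left.2 (fun ω h h' => hne ?_)
      exact Eq.trans (Eq.symm h) h'
    · intro c _
      exact hmeas i (measurableSet_singleton c)

/-- Conditioning on the assignment turns the law into a sum of products over units, a form in which
symmetry under relabelling is visible. -/
theorem measureReal_observedSet_eq (hZ : Measurable Z) (hM₁ : Measurable M₁)
    (hM₀ : Measurable M₀) (hCRE : IsCRE P n₁ Z M₁ M₀) (hMAR : IsMAR P M₁ M₀ p)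
    (A : Finset (Fin n)) :
    P.real {ω | observedSet Z M₁ M₀ ω = A} =
      ∑ z : Fin n → Bool,
        (if (Finset.univ.filter (fun i => z i = true)).card = n₁ then 1 / (n.choose n₁ : ℝ)
          else 0) * ∏ i, realizedMass p (z i) (decide (i ∈ A)) := by
  have hcell : ∀ z : Fin n → Bool, MeasurableSet
      {x : (Fin n → Bool) × (Fin n → Bool) |
        ∀ i, (if z i = true then x.1 i else x.2 i) = decide (i ∈ A)} :=
    fun z => (Set.toFinite _).measurableSet
  have hU : {ω | observedSet Z M₁ M₀ ω = A} = ⋃ z ∈ (Finset.univ : Finset (Fin n → Bool)),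
      (Z ⁻¹' {z} ∩ (fun ω => (M₁ ω, M₀ ω)) ⁻¹'
        {x | ∀ i, (if z i = true then x.1 i else x.2 i) = decide (i ∈ A)}) := by
    ext ω
    simp only [observedSet, Set.mem_ofPred_eq, Finset.mem_univ, Set.iUnion_true, Set.mem_iUnion,
      Set.mem_inter_iff, Set.mem_preimage, Set.mem_singleton_iff,
      exists_eq_left', Finset.ext_iff]
    refine forall_congr' (fun i => ?_)
    rw [Finset.mem_filter, @Bool.eq_iff_iff _ (decide (i ∈ A)), decide_eq_true_iff]
    simp only [Finset.mem_univ, true_and, realizedM]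
  rw [hU, measureReal_biUnion_finset]
  · refine Finset.sum_congr rfl (fun z _ => ?_)
    rw [← hCRE.law z, ← hMAR.measureReal_forall hM₁ hM₀ z]
    have := congrArg ENNReal.toReal
      (hCRE.indep.measure_inter_preimage_eq_mul _ _ (measurableSet_singleton z) (hcell z))
    rw [ENNReal.toReal_mul] at this
    exact this
  · intro z _ z' _ hne
    refine Set.disjoint_left.2 (fun ω h h' => hne ?_)
    exact Eq.trans (Eq.symm h.1) h'.1
  · intro z _
    exact (hZ (measurableSet_singleton z)).inter ((hM₁.prodMk hM₀) (hcell z))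

/-- The law of the observed set is invariant under permutations of the units. -/
theorem measureReal_observedSet_eq_of_card_eq (hZ : Measurable Z) (hM₁ : Measurable M₁)
    (hM₀ : Measurable M₀) (hCRE : IsCRE P n₁ Z M₁ M₀) (hMAR : IsMAR P M₁ M₀ p)
    {A B : Finset (Fin n)} (hAB : A.card = B.card) :
    P.real {ω | observedSet Z M₁ M₀ ω = A} = P.real {ω | observedSet Z M₁ M₀ ω = B} := by
  -- Sets of equal size are matched by a permutation; reindexing assignments by it carries one sum
  -- to the other.
  obtain ⟨π, hπ⟩ : ∃ π : Equiv.Perm (Fin n), ∀ i, π i ∈ B ↔ i ∈ A := by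
    have e : {i // i ∈ A} ≃ {i // i ∈ B} := Fintype.equivOfCardEq (by simpa using hAB)
    refine ⟨e.extendSubtype, fun i => ⟨fun h => ?_, fun h => e.extendSubtype_mem i h⟩⟩
    by_contra hi
    exact e.extendSubtype_not_mem i hi h
  rw [measureReal_observedSet_eq hZ hM₁ hM₀ hCRE hMAR,
    measureReal_observedSet_eq hZ hM₁ hM₀ hCRE hMAR]
  refine (Fintype.sum_equiv (π.arrowCongr (Equiv.refl Bool)).symm _ _ (fun z => ?_)).symm
  have hz : (π.arrowCongr (Equiv.refl Bool)).symm z = z ∘ π := rfl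
  rw [hz]
  have h1 : (Finset.univ.filter (fun i => (z ∘ π) i = true)).card =
      (Finset.univ.filter (fun i => z i = true)).card :=
    Finset.card_equiv π (by simp)
  rw [h1]
  congr 1
  rw [← Equiv.prod_comp π]
  refine Finset.prod_congr rfl (fun i _ => ?_)
  simp only [hπ, Function.comp_apply]

theorem measureReal_card_observedSet (hZ : Measurable Z) (hM₁ : Measurable M₁)
    (hM₀ : Measurable M₀) (hCRE : IsCRE P n₁ Z M₁ M₀) (hMAR : IsMAR P M₁ M₀ p)
    (A : Finset (Fin n)) :
    P.real {ω | (observedSet Z M₁ M₀ ω).card = A.card} =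
      n.choose A.card * P.real {ω | observedSet Z M₁ M₀ ω = A} := by
  have h := measureReal_observedSet_mem (P := P) hZ hM₁ hM₀
    (Finset.univ.powersetCard A.card)
  simp only [Finset.mem_powersetCard, Finset.subset_univ, true_and] at h
  rw [h, Finset.sum_congr rfl (fun B hB => measureReal_observedSet_eq_of_card_eq hZ hM₁ hM₀
    hCRE hMAR (Finset.mem_powersetCard.1 hB).2)]
  simp

theorem measureReal_observedSet_mem_of_card_eq (hZ : Measurable Z) (hM₁ : Measurable M₁)
    (hM₀ : Measurable M₀) (hCRE : IsCRE P n₁ Z M₁ M₀) (hMAR : IsMAR P M₁ M₀ p)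
    {m : ℕ} (B : Finset (Finset (Fin n))) (hB : ∀ A ∈ B, A.card = m) :
    P.real {ω | observedSet Z M₁ M₀ ω ∈ B} =
      P.real {ω | (observedSet Z M₁ M₀ ω).card = m} * (B.card / (n.choose m : ℝ)) := by
  rw [measureReal_observedSet_mem hZ hM₁ hM₀]
  have h : ∀ A ∈ B, P.real {ω | observedSet Z M₁ M₀ ω = A} =
      P.real {ω | (observedSet Z M₁ M₀ ω).card = m} / (n.choose m : ℝ) := by
    intro A hA
    have hle : A.card ≤ n := by simpa using Finset.card_le_univ A
    have hpos : (n.choose A.card : ℝ) ≠ 0 := by exact_mod_cast (Nat.choose_pos hle).ne'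
    rw [← hB A hA, measureReal_card_observedSet hZ hM₁ hM₀ hCRE hMAR]
    field_simp
  rw [Finset.sum_congr rfl h, Finset.sum_const, nsmul_eq_mul]
  ring

end Sampling

end Attrition

open Attrition

theorem mainTheorem8 {Ω : Type*} [MeasurableSpace Ω] (P : Measure Ω) [IsProbabilityMeasure P]
    (n n₁ : ℕ) (hn₁ : 0 < n₁) (hn₁n : n₁ < n)
    (Y₁ Y₀ : Fin n → ℝ)
    (Z M₁ M₀ : Ω → Fin n → Bool)
    (hZ : Measurable Z) (hM₁ : Measurable M₁) (hM₀ : Measurable M₀)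
    (hCRE : Attrition.IsCRE P n₁ Z M₁ M₀)
    (p : Bool × Bool → ℝ) (hMAR : Attrition.IsMAR P M₁ M₀ p)
    (S : Ω → Finset (Fin n)) (hS : S = Attrition.observedSet Z M₁ M₀)
    (τ : Fin n → ℝ) (hτ : τ = Attrition.effect Y₁ Y₀)
    (α : ℝ) (hα : 0 < α) (hα' : α < 1 / 2)
    (I : Ω → ℕ → Set ℝ)
    (hI : ∀ ω l, 1 ≤ l → l ≤ (S ω).card → Attrition.IsLowerBoundInterval (I ω l))
    (J : ℕ) (hJ : 1 ≤ J) (k : Fin J → ℕ) (hk : StrictMono k)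
    (hk1 : ∀ j, 1 ≤ k j) (hkn : ∀ j, k j ≤ n)
    (k' : ℕ → Fin J → ℕ) (hk' : ∀ m ≤ n, Monotone (k' m)) (hk'm : ∀ m ≤ n, ∀ j, k' m j ≤ m) :
    -- given its size, the observed set is a simple random sample of all units
    (∀ m : ℕ, P {ω | (S ω).card = m} ≠ 0 → ∀ A : Finset (Fin n), A.card = m →
      (P[|{ω | (S ω).card = m}]).real {ω | S ω = A} = 1 / (n.choose m : ℝ)) ∧
    -- the intervals are of the form `(c, ∞)` or `[c, ∞)`
    (∀ ω j, Attrition.IsLowerBoundInterval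
      (Attrition.extendZero (I ω) (k' (S ω).card j))) ∧
    -- simultaneous coverage conditional on the size of the observed set
    (∀ m : ℕ, P {ω | (S ω).card = m} ≠ 0 →
      1 - 2 * α ≤ (P[|{ω | (S ω).card = m}]).real (Attrition.predictionEvent τ S I) →
      1 - 2 * α - Attrition.deltaH (k' m) n m k ≤
        (P[|{ω | (S ω).card = m}]).real (Attrition.coverageEvent τ S I k k')) ∧
    -- simultaneous coverage averaged over the size of the observed set
    (1 - 2 * α ≤ P.real (Attrition.predictionEvent τ S I) →
      1 - 2 * α -
          ∑ m ∈ Finset.range (n + 1),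
            P.real {ω | (S ω).card = m} * Attrition.deltaH (k' m) n m k ≤
        P.real (Attrition.coverageEvent τ S I k k')) := by
  subst hS
  have hmeas : ∀ m : ℕ, MeasurableSet {ω | (observedSet Z M₁ M₀ ω).card = m} := fun m =>
    measurableSet_observedSet_mem hZ hM₁ hM₀ {A | A.card = m}
  have hbad : ∀ m, P.real {ω | observedSet Z M₁ M₀ ω ∈
      badSamples (Tuple.sort τ).symm k (k' m) m} =
      P.real {ω | (observedSet Z M₁ M₀ ω).card = m} * deltaH (k' m) n m k := by
    intro m
    rw [deltaH_eq_card_div (Tuple.sort τ).symm hk hkn]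
    exact measureReal_observedSet_mem_of_card_eq hZ hM₁ hM₀ hCRE hMAR _
      (fun A hA => (Finset.mem_filter.1 hA).2.1)
  refine ⟨?_, ?_, ?_, ?_⟩
  · rintro m hm A rfl
    have hpos : P.real {ω | (observedSet Z M₁ M₀ ω).card = A.card} ≠ 0 :=
      (measureReal_ne_zero_iff).2 hm
    rw [measureReal_cond_apply (hmeas _)]
    have hinter : {ω | (observedSet Z M₁ M₀ ω).card = A.card} ∩
        {ω | observedSet Z M₁ M₀ ω = A} = {ω | observedSet Z M₁ M₀ ω = A} :=
      Set.inter_eq_right.2 (fun ω (h : _ = A) => congrArg Finset.card h)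
    rw [hinter]
    -- The size has positive probability, so `P(S = A)` is nonzero and cancels.
    rw [measureReal_card_observedSet hZ hM₁ hM₀ hCRE hMAR] at hpos ⊢
    have h1 := left_ne_zero_of_mul hpos
    have h2 := right_ne_zero_of_mul hpos
    field_simp
  · intro ω j
    rw [extendZero]
    split_ifs with h0
    · exact Or.inl rfl
    · exact hI ω _ (Nat.one_le_iff_ne_zero.2 h0)
        (hk'm _ (by simpa using Finset.card_le_univ (observedSet Z M₁ M₀ ω)) j)
  · intro m hm hpred
    have hpos : 0 < P.real {ω | (observedSet Z M₁ M₀ ω).card = m} :=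
      lt_of_le_of_ne measureReal_nonneg ((measureReal_ne_zero_iff).2 hm).symm
    -- Clearing the denominator leaves joint probabilities. Monotonicity and subadditivity then
    -- suffice, with no measurability of the prediction or coverage events.
    rw [measureReal_cond_apply (hmeas m), ← div_eq_inv_mul, le_div_iff₀ hpos] at hpred ⊢
    have hsub : {ω | (observedSet Z M₁ M₀ ω).card = m} ∩
        predictionEvent τ (observedSet Z M₁ M₀) I ⊆
        ({ω | (observedSet Z M₁ M₀ ω).card = m} ∩
          coverageEvent τ (observedSet Z M₁ M₀) I k k') ∪
        {ω | observedSet Z M₁ M₀ ω ∈ badSamples (Tuple.sort τ).symm k (k' m) m} := by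
      rintro ω ⟨rfl, hω⟩
      by_cases hb : observedSet Z M₁ M₀ ω ∈ badSamples (Tuple.sort τ).symm k
          (k' (observedSet Z M₁ M₀ ω).card) (observedSet Z M₁ M₀ ω).card
      · exact Or.inr hb
      · exact Or.inl ⟨rfl, mem_coverageEvent_of_notMem_badSamples (hI ω) hk1 hkn hk'm hω hb⟩
    have hle := (measureReal_mono (μ := P) hsub).trans (measureReal_union_le _ _)
    rw [hbad] at hle
    linarith
  · intro hpred
    -- Bad events are split by size, so their joint probabilities sum to the expectation of
    -- `deltaH`.
    have hsub : predictionEvent τ (observedSet Z M₁ M₀) I ⊆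
        coverageEvent τ (observedSet Z M₁ M₀) I k k' ∪
        ⋃ m ∈ Finset.range (n + 1),
          {ω | observedSet Z M₁ M₀ ω ∈ badSamples (Tuple.sort τ).symm k (k' m) m} := by
      intro ω hω
      by_cases hb : observedSet Z M₁ M₀ ω ∈ badSamples (Tuple.sort τ).symm k
          (k' (observedSet Z M₁ M₀ ω).card) (observedSet Z M₁ M₀ ω).card
      · refine Or.inr (Set.mem_biUnion (x := (observedSet Z M₁ M₀ ω).card) ?_ hb)
        simpa [Nat.lt_succ_iff] using Finset.card_le_univ (observedSet Z M₁ M₀ ω)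
      · exact Or.inl (mem_coverageEvent_of_notMem_badSamples (hI ω) hk1 hkn hk'm hω hb)
    have hle := (measureReal_mono (μ := P) hsub).trans (measureReal_union_le _ _)
    have hle2 := measureReal_biUnion_finset_le (μ := P) (Finset.range (n + 1))
      (fun m => {ω | observedSet Z M₁ M₀ ω ∈ badSamples (Tuple.sort τ).symm k (k' m) m})
    rw [Finset.sum_congr rfl (fun m _ => hbad m)] at hle2
    linarith
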